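/- Let $K$ be a field of characteristic zero and let $1\le n\le 5$. Let $K_n$ be the complete graph on $n$ vertices, with $N=\binom n2$ edges, assign a variable $x_e$ to each edge $e$, and let $$F_{K_n}=\sum_{T}\prod_{e\in E(T)}x_e ,$$ where $T$ runs over the spanning trees of $K_n$. Let $\operatorname{Ann}(F_{K_n})$ be the ideal of all $P\in K[x_1,\dots,x_N]$ with $P(\partial/\partial x_1,\dots,\partial/\partial x_N)F_{K_n}=0$, and let $A=A_{M(K_n)}=K[x_1,\dots,x_N]/\operatorname{Ann}(F_{K_n})$, with $A_k$ the image in $A$ of the homogeneous polynomials of degree $k$. Then $A$ is an Artinian Gorenstein algebra, graded as $A=\bigoplus_{k=0}^{s}A_k$ with $A_s\ne 0$, where $s=n-1$, and $A$ has the strong Lefschetz property: there is an element $L\in A_1$ such that the multiplication map $\times L^{s-2k}\colon A_k\to A_{s-k}$ is bijective for all integers $0\le k\le s/2$. Moreover, the element $L=x_1+\cdots+x_N$ is such a strong Lefschetz element. -/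

import Mathlib

/-- Two partial derivatives of a polynomial commute. -/
theorem pderiv_lin_comm {σ K : Type*} [Field K] (i j : σ) :
    (MvPolynomial.pderiv (R := K) i).toLinearMap * (MvPolynomial.pderiv j).toLinearMap =
      ((MvPolynomial.pderiv j).toLinearMap * (MvPolynomial.pderiv i).toLinearMap :
        Module.End K (MvPolynomial σ K)) := by
  classical
  have h : ⁅MvPolynomial.pderiv (R := K) i, MvPolynomial.pderiv (R := K) j⁆ = 0 := by
    apply MvPolynomial.derivation_ext
    intro k
    simp only [Derivation.commutator_apply, MvPolynomial.pderiv_X, Pi.single_apply]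
    split_ifs <;> simp
  refine LinearMap.ext fun p => ?_
  have hp := congrArg (fun D => D p) h
  simp only [Derivation.commutator_apply, Derivation.coe_zero, Pi.zero_apply,
    sub_eq_zero] at hp
  exact hp

open scoped IsMulCommutative in
/-- The algebra homomorphism `P ↦ P(∂/∂x)` from polynomials to differential operators
with constant coefficients; it sends the variable `x i` to `∂/∂x i` (see `diffOp_X`). -/
noncomputable def diffOp (σ K : Type*) [Field K] :
    MvPolynomial σ K →ₐ[K] Module.End K (MvPolynomial σ K) :=
  haveI : IsMulCommutative (Algebra.adjoin K (Set.range fun i : σ =>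
      ((MvPolynomial.pderiv i).toLinearMap : Module.End K (MvPolynomial σ K)))) :=
    Algebra.isMulCommutative_adjoin K (by
      rintro _ ⟨i, rfl⟩ _ ⟨j, rfl⟩
      exact pderiv_lin_comm i j)
  (Algebra.adjoin K (Set.range fun i : σ =>
      ((MvPolynomial.pderiv i).toLinearMap : Module.End K (MvPolynomial σ K)))).val.comp
    (MvPolynomial.aeval fun i : σ =>
      (⟨(MvPolynomial.pderiv i).toLinearMap, Algebra.subset_adjoin ⟨i, rfl⟩⟩ :
        Algebra.adjoin K (Set.range fun i : σ =>
          ((MvPolynomial.pderiv i).toLinearMap : Module.End K (MvPolynomial σ K)))))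

theorem diffOp_X {σ K : Type*} [Field K] (i : σ) :
    diffOp σ K (MvPolynomial.X i) = (MvPolynomial.pderiv i).toLinearMap := by
  simp [diffOp]

/-- `Ann(F)`: the ideal of all polynomials `P` with `P(∂/∂x) F = 0`. -/
noncomputable def diffAnn {σ K : Type*} [Field K] (F : MvPolynomial σ K) :
    Ideal (MvPolynomial σ K) where
  carrier := {P | diffOp σ K P F = 0}
  add_mem' := by
    intro P Q hP hQ
    simp only [Set.mem_ofPred_eq] at hP hQ ⊢
    rw [map_add, LinearMap.add_apply, hP, hQ, add_zero]
  zero_mem' := by simp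
  smul_mem' := by
    intro P Q hQ
    simp only [Set.mem_ofPred_eq] at hQ ⊢
    rw [smul_eq_mul, map_mul, Module.End.mul_apply, hQ, map_zero]

/-- The degree `k` part of a quotient of a polynomial ring: the image of the space of
homogeneous polynomials of degree `k`. -/
noncomputable def quotientGrading {σ K : Type*} [Field K] (I : Ideal (MvPolynomial σ K))
    (k : ℕ) : Submodule K (MvPolynomial σ K ⧸ I) :=
  (MvPolynomial.homogeneousSubmodule σ K k).map (Ideal.Quotient.mkₐ K I).toLinearMap

/-- A set `T` of edges of `G` is (the edge set of) a spanning tree of `G`: the graph with all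
the vertices of `G` and with edge set `T` is a tree. -/
def IsSpanningTree {V : Type*} (G : SimpleGraph V) (T : Finset G.edgeSet) : Prop :=
  (SimpleGraph.fromEdgeSet (Subtype.val '' (T : Set G.edgeSet))).IsTree

open Classical in
/-- The Kirchhoff polynomial `F_G = ∑_T ∏_{e ∈ T} x_e`, summed over the spanning trees `T`. -/
noncomputable def kirchhoffPolynomial {V : Type*} [Fintype V] (K : Type*) [Field K]
    (G : SimpleGraph V) : MvPolynomial G.edgeSet K :=
  ∑ T : Finset G.edgeSet with IsSpanningTree G T, ∏ e ∈ T, MvPolynomial.X e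

/-- The algebra `A_{M(G)} = K[x_e : e ∈ E(G)] / Ann(F_G)`. -/
abbrev GraphicAlgebra {V : Type*} [Fintype V] (K : Type*) [Field K] (G : SimpleGraph V) :
    Type _ :=
  MvPolynomial G.edgeSet K ⧸ diffAnn (kirchhoffPolynomial K G)

/-- The grading of `A_{M(G)}` by degree. -/
noncomputable abbrev graphicGrading {V : Type*} [Fintype V] (K : Type*) [Field K]
    (G : SimpleGraph V) : ℕ → Submodule K (GraphicAlgebra K G) :=
  quotientGrading (diffAnn (kirchhoffPolynomial K G))

open Classical in
/-- The class of `∑_e x_e` in `A_{M(G)}`. -/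
noncomputable def edgeSum {V : Type*} [Fintype V] (K : Type*) [Field K]
    (G : SimpleGraph V) : GraphicAlgebra K G :=
  Ideal.Quotient.mk _ (∑ e : G.edgeSet, MvPolynomial.X e)

/-- A (local) Artinian Gorenstein ring: an Artinian local ring whose socle, the annihilator of
the maximal ideal, is a simple module. -/
structure IsArtinianGorenstein (A : Type*) [CommRing A] : Prop
    extends IsArtinianRing A, IsLocalRing A where
  isSimple_socle : IsSimpleModule A (IsLocalRing.maximalIdeal A).annihilator

/-- `A = ⨁_{k=0}^s A_k` is a graded Artinian algebra with `A_s ≠ 0`. -/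
structure IsGradedArtinian {K A : Type*} [Field K] [CommRing A] [Algebra K A]
    (𝒜 : ℕ → Submodule K A) (s : ℕ) : Prop where
  artinian : IsArtinianRing A
  graded : SetLike.GradedMonoid 𝒜
  internal : DirectSum.IsInternal 𝒜
  top_ne : 𝒜 s ≠ ⊥
  eq_bot : ∀ k, s < k → 𝒜 k = ⊥

/-- `L` is a strong Lefschetz element of `A = ⨁_{k=0}^s A_k`: it lies in `A_1`, and
multiplication by `L ^ (s - 2k)` is a bijection `A_k → A_{s-k}` whenever `k ≤ s / 2`. -/
structure IsStrongLefschetzElement {K A : Type*} [Field K] [CommRing A] [Algebra K A]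
    (𝒜 : ℕ → Submodule K A) (s : ℕ) (L : A) : Prop where
  mem : L ∈ 𝒜 1
  bij : ∀ k, 2 * k ≤ s →
    Set.BijOn (fun a => L ^ (s - 2 * k) * a) (𝒜 k : Set A) (𝒜 (s - k) : Set A)

/-- The strong Lefschetz property of a graded Artinian algebra `A = ⨁_{k=0}^s A_k`, `A_s ≠ 0`
(the number `s` is determined by the grading). -/
def HasStrongLefschetzProperty {K A : Type*} [Field K] [CommRing A] [Algebra K A]
    (𝒜 : ℕ → Submodule K A) : Prop :=
  ∃ s, IsGradedArtinian 𝒜 s ∧ ∃ L, IsStrongLefschetzElement 𝒜 s L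

/-! The functional `φ P = (P(∂/∂x) F)(0)` makes `(P, Q) ↦ φ (P Q)` a nondegenerate pairing on
`A = K[x] / Ann(F)`, so `A` is Gorenstein and `A_k`, `A_{s-k}` are dual: bijectivity of
`×L^(s-2k)` reduces to injectivity. By Euler's identity, for `L = ∑ x_i` and `P`, `Q` of degree `k`,
`φ (L^(s-2k) P Q)` is `(s-2k)!` times the value of `(P Q)(∂/∂x) F` at `(1, …, 1)`, so injectivity
is nondegeneracy of the `k`-th Hessian form of `F` at `(1, …, 1)`. For `s ≤ 4` only
`F(1, …, 1)`, the number of spanning trees, and the ordinary Hessian matrix occur.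

The `(e, f)` entry of that Hessian matrix, for `e ≠ f`, counts the spanning trees through `e` and
`f`. In `Kₙ` it depends only on whether `e` and `f` meet, so the matrix is a combination of the
identity, `Nᵀ N` for the incidence matrix `N`, and the all-ones matrix. Its eigenvalues are then
explicit, and they are nonzero because the two counts are in the ratio `3 : 4`.
-/

open MvPolynomial

section DiffOp

variable {σ K : Type*} [Field K]

theorem diffOp_mul_apply (P Q G : MvPolynomial σ K) :
    diffOp σ K (P * Q) G = diffOp σ K P (diffOp σ K Q G) := by
  rw [map_mul, Module.End.mul_apply]

theorem diffOp_X_apply (i : σ) (G : MvPolynomial σ K) : diffOp σ K (X i) G = pderiv i G := by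
  rw [diffOp_X, Derivation.coeFn_coe]

theorem coeff_diffOp_X_pow (i : σ) (k : ℕ) (c : σ →₀ ℕ) (G : MvPolynomial σ K) :
    coeff c (diffOp σ K (X i ^ k) G) =
      ((c i + 1).ascFactorial k : ℕ) * coeff (Finsupp.single i k + c) G := by
  induction k generalizing c with
  | zero => simp
  | succ k ih =>
    have hfactorial : (c i + 1).ascFactorial (k + 1) = (c i + 1) * (c i + 2).ascFactorial k := by
      rw [Nat.ascFactorial_succ, Nat.succ_ascFactorial]
    rw [pow_succ', diffOp_mul_apply, diffOp_X_apply, coeff_pderiv, ih, Finsupp.add_apply,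
      Finsupp.single_eq_same, hfactorial, Finsupp.single_add, add_comm c,
      add_assoc (Finsupp.single i k), Nat.cast_mul, Nat.cast_add_one]
    ring

theorem coeff_diffOp_monomial (b c : σ →₀ ℕ) (G : MvPolynomial σ K) :
    coeff c (diffOp σ K (monomial b 1) G) =
      (b.prod fun i k => (c i + 1).ascFactorial k : ℕ) * coeff (b + c) G := by
  classical
  induction b using Finsupp.induction generalizing c with
  | zero => simp
  | single_add i k b hi _ ih =>
    have hprod : (b.prod fun j l => ((Finsupp.single i k + c) j + 1).ascFactorial l) =
        b.prod fun j l => (c j + 1).ascFactorial l :=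
      Finsupp.prod_congr fun j hj => by
        rw [Finsupp.add_apply, Finsupp.single_eq_of_ne (ne_of_mem_of_not_mem hj hi), zero_add]
    have hmonomial : monomial (Finsupp.single i k + b) (1 : K) = X i ^ k * monomial b 1 := by
      rw [X_pow_eq_monomial, monomial_mul, one_mul]
    rw [hmonomial, diffOp_mul_apply, coeff_diffOp_X_pow, ih, hprod,
      Finsupp.prod_add_index_of_disjoint, Finsupp.prod_single_index,
      Nat.cast_mul, mul_assoc, add_left_comm, add_assoc]
    · exact Nat.ascFactorial_zero _
    · exact Finset.disjoint_of_subset_left Finsupp.support_single_subset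
        (Finset.disjoint_singleton_left.2 hi)

theorem coeff_diffOp (P G : MvPolynomial σ K) (c : σ →₀ ℕ) :
    coeff c (diffOp σ K P G) = ∑ b ∈ P.support,
      coeff b P * ((b.prod fun i k => (c i + 1).ascFactorial k : ℕ) * coeff (b + c) G) := by
  conv_lhs => rw [P.as_sum, map_sum, LinearMap.sum_apply, coeff_sum]
  refine Finset.sum_congr rfl fun b _ => ?_
  rw [← coeff_diffOp_monomial, ← smul_eq_mul, ← coeff_smul, ← LinearMap.smul_apply, ← map_smul,
    smul_monomial, smul_eq_mul, mul_one]

theorem exists_mem_support_of_mem_support_diffOp {P G : MvPolynomial σ K} {c : σ →₀ ℕ}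
    (hc : c ∈ (diffOp σ K P G).support) : ∃ b ∈ P.support, b + c ∈ G.support := by
  rw [mem_support_iff, coeff_diffOp] at hc
  obtain ⟨b, hb, h⟩ := Finset.exists_ne_zero_of_sum_ne_zero hc
  exact ⟨b, hb, mem_support_iff.2 (right_ne_zero_of_mul (right_ne_zero_of_mul h))⟩

theorem totalDegree_diffOp_le (P G : MvPolynomial σ K) :
    (diffOp σ K P G).totalDegree ≤ G.totalDegree := by
  refine Finset.sup_le fun c hc => ?_
  obtain ⟨b, -, hbc⟩ := exists_mem_support_of_mem_support_diffOp hc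
  exact (Finsupp.degree_mono le_add_self).trans (le_totalDegree hbc)

theorem diffOp_eq_zero_of_totalDegree_lt {P G : MvPolynomial σ K}
    (h : ∀ b ∈ P.support, G.totalDegree < b.degree) : diffOp σ K P G = 0 := by
  by_contra hne
  obtain ⟨c, hc⟩ := support_nonempty.2 hne
  obtain ⟨b, hb, hbc⟩ := exists_mem_support_of_mem_support_diffOp hc
  exact ((h b hb).trans_le (Finsupp.degree_mono le_self_add)).not_ge (le_totalDegree hbc)

theorem diffOp_isHomogeneous {P G : MvPolynomial σ K} {k d : ℕ} (hP : P.IsHomogeneous k)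
    (hG : G.IsHomogeneous d) : (diffOp σ K P G).IsHomogeneous (d - k) := by
  intro c hc
  obtain ⟨b, hb, hbc⟩ := exists_mem_support_of_mem_support_diffOp (mem_support_iff.2 hc)
  rw [← hP (mem_support_iff.1 hb), ← hG (mem_support_iff.1 hbc), map_add, add_tsub_cancel_left]

theorem diffOp_eq_zero_of_isHomogeneous {P G : MvPolynomial σ K} {k d : ℕ}
    (hP : P.IsHomogeneous k) (hG : G.IsHomogeneous d) (hdk : d < k) : diffOp σ K P G = 0 :=
  diffOp_eq_zero_of_totalDegree_lt fun _ hb =>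
    (hG.totalDegree_le.trans_lt hdk).trans_eq (hP.degree_eq_sum_deg_support hb)

theorem homogeneousComponent_diffOp {G : MvPolynomial σ K} {d k : ℕ} (hG : G.IsHomogeneous d)
    (hk : k ≤ d) (P : MvPolynomial σ K) :
    homogeneousComponent (d - k) (diffOp σ K P G) = diffOp σ K (homogeneousComponent k P) G := by
  have hrest : homogeneousComponent (d - k) (diffOp σ K (P - homogeneousComponent k P) G) = 0 := by
    ext c
    rw [coeff_homogeneousComponent, coeff_zero, ite_eq_right_iff]
    intro hc
    by_contra hne
    obtain ⟨b, hb, hbc⟩ := exists_mem_support_of_mem_support_diffOp (mem_support_iff.2 hne)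
    have hdegree : d = (b + c).degree := hG.degree_eq_sum_deg_support hbc
    rw [map_add] at hdegree
    rw [mem_support_iff, coeff_sub, coeff_homogeneousComponent, if_pos (by lia), sub_self] at hb
    exact hb rfl
  rw [map_sub, LinearMap.sub_apply, map_sub, sub_eq_zero] at hrest
  rw [hrest, homogeneousComponent_eq_self
    (diffOp_isHomogeneous (homogeneousComponent_isHomogeneous k P) hG)]

theorem eq_zero_of_forall_coeff_zero_diffOp [CharZero K] {G : MvPolynomial σ K}
    (h : ∀ Q, coeff 0 (diffOp σ K Q G) = 0) : G = 0 := by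
  ext b
  have hb := h (monomial b 1)
  rw [coeff_diffOp_monomial, add_zero, mul_eq_zero, Nat.cast_eq_zero] at hb
  refine hb.resolve_left (Finset.prod_ne_zero_iff.2 fun i _ => ?_)
  simpa using Nat.factorial_ne_zero (b i)

end DiffOp

section Socle

theorem annihilator_maximalIdeal_ne_bot (A : Type*) [CommRing A] [IsArtinianRing A]
    [IsLocalRing A] : (IsLocalRing.maximalIdeal A).annihilator ≠ ⊥ := by
  obtain ⟨p, hp⟩ := associatedPrimes.nonempty A A
  obtain ⟨hprime, x, hx⟩ := isAssociatedPrime_iff.1 hp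
  have hmax : p = IsLocalRing.maximalIdeal A := IsLocalRing.eq_maximalIdeal inferInstance
  refine (Submodule.ne_bot_iff _).2 ⟨x, Submodule.mem_annihilator.2 fun b hb => ?_, ?_⟩
  · rw [← hmax, hx, Submodule.mem_colon_singleton, Submodule.mem_bot] at hb
    rwa [smul_eq_mul, mul_comm]
  · rintro rfl
    exact hprime.ne_top (hx.trans (by simp))

variable {K A : Type*} [Field K] [CommRing A] [Algebra K A]

theorem isLocalRing_of_forall_exists_isNilpotent_sub [Nontrivial A]
    (h : ∀ a : A, ∃ c : K, IsNilpotent (a - algebraMap K A c)) : IsLocalRing A := by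
  refine .of_isUnit_or_isUnit_one_sub_self fun a => ?_
  obtain ⟨c, hc⟩ := h a
  by_cases hc0 : c = 0
  · right
    rw [hc0, map_zero, sub_zero] at hc
    exact hc.isUnit_one_sub
  · left
    have := hc.isUnit_add_left_of_commute ((isUnit_iff_ne_zero.2 hc0).map (algebraMap K A))
      (Commute.all _ _)
    rwa [add_sub_cancel] at this

theorem mul_eq_algebraMap_mul_of_mem_annihilator_maximalIdeal [IsLocalRing A] {x b : A} {c : K}
    (hx : x ∈ (IsLocalRing.maximalIdeal A).annihilator) (hc : IsNilpotent (b - algebraMap K A c)) :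
    x * b = c • x := by
  have hmem : b - algebraMap K A c ∈ IsLocalRing.maximalIdeal A :=
    (IsLocalRing.mem_maximalIdeal _).2 hc.not_isUnit
  have := Submodule.mem_annihilator.1 hx _ hmem
  rw [smul_eq_mul, mul_sub, sub_eq_zero] at this
  rw [this, Algebra.smul_def, mul_comm]

theorem isArtinianGorenstein_of_separatingLeft [IsArtinianRing A] [Nontrivial A]
    (hA : ∀ a : A, ∃ c : K, IsNilpotent (a - algebraMap K A c)) (φ : A →ₗ[K] K)
    (hφ : ((LinearMap.mul K A).compr₂ φ).SeparatingLeft) : IsArtinianGorenstein A := by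
  have hlocal : IsLocalRing A := isLocalRing_of_forall_exists_isNilpotent_sub hA
  have hker : ∀ x ∈ (IsLocalRing.maximalIdeal A).annihilator, φ x = 0 → x = 0 := by
    refine fun x hx hφx => hφ x fun b => ?_
    obtain ⟨c, hc⟩ := hA b
    rw [LinearMap.compr₂_apply, LinearMap.mul_apply',
      mul_eq_algebraMap_mul_of_mem_annihilator_maximalIdeal hx hc, map_smul, hφx, smul_zero]
  have hnontrivial : Nontrivial (IsLocalRing.maximalIdeal A).annihilator :=
    Submodule.nontrivial_iff_ne_bot.2 (annihilator_maximalIdeal_ne_bot A)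
  refine { ‹IsArtinianRing A›, hlocal with
    isSimple_socle := isSimpleModule_iff_toSpanSingleton_surjective.2 ⟨hnontrivial, ?_⟩ }
  rintro ⟨x, hx⟩ hx0 ⟨y, hy⟩
  have hφx : φ x ≠ 0 := fun h => hx0 (Subtype.ext (hker x hx h))
  refine ⟨algebraMap K A (φ y / φ x), Subtype.ext (sub_eq_zero.1 (hker _ ?_ ?_))⟩
  · exact Submodule.sub_mem _ (Submodule.smul_mem _ _ hx) hy
  · simp [hφx]

end Socle

section GradedDuality

variable {K A : Type*} [Field K] [CommRing A] [Algebra K A]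

/-- `φ` is an orientation of socle degree `s` of the algebra `A = ⨁ 𝒜 k`: a functional supported
in degree `s` whose associated pairing `(a, b) ↦ φ (a * b)` on `A` is nondegenerate. -/
structure IsOrientation (𝒜 : ℕ → Submodule K A) (s : ℕ) (φ : A →ₗ[K] K) : Prop where
  eq_zero_of_ne : ∀ k ≠ s, ∀ a ∈ 𝒜 k, φ a = 0
  separatingLeft : ((LinearMap.mul K A).compr₂ φ).SeparatingLeft

namespace IsOrientation

variable {𝒜 : ℕ → Submodule K A} {s : ℕ} {φ : A →ₗ[K] K}

theorem eq_zero_of_forall_mul [SetLike.GradedMonoid 𝒜] (hφ : IsOrientation 𝒜 s φ)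
    (htop : ⨆ k, 𝒜 k = ⊤) {k m : ℕ} (hkm : k + m = s) {a : A} (ha : a ∈ 𝒜 k)
    (h : ∀ b ∈ 𝒜 m, φ (a * b) = 0) : a = 0 := by
  have hker : ⨆ j, 𝒜 j ≤ LinearMap.ker (φ ∘ₗ LinearMap.mulLeft K a) := by
    refine iSup_le fun j b hb => ?_
    rw [LinearMap.mem_ker, LinearMap.comp_apply, LinearMap.mulLeft_apply]
    obtain rfl | hj := eq_or_ne j m
    · exact h b hb
    · exact hφ.eq_zero_of_ne (k + j) (by lia) _ (SetLike.mul_mem_graded ha hb)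
  exact hφ.separatingLeft a fun b => hker (htop ▸ Submodule.mem_top)

theorem finrank_le [SetLike.GradedMonoid 𝒜] [Module.Finite K A] (hφ : IsOrientation 𝒜 s φ)
    (htop : ⨆ k, 𝒜 k = ⊤) {k m : ℕ} (hkm : k + m = s) :
    Module.finrank K (𝒜 k) ≤ Module.finrank K (𝒜 m) := by
  rw [← Subspace.dual_finrank_eq (V := 𝒜 m)]
  refine LinearMap.finrank_le_finrank_of_injective
    (f := ((LinearMap.mul K A).compr₂ φ).domRestrict₁₂ (𝒜 k) (𝒜 m)) ?_
  rw [injective_iff_map_eq_zero]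
  exact fun a ha => Subtype.ext <| hφ.eq_zero_of_forall_mul htop hkm a.2
    fun b hb => LinearMap.congr_fun ha ⟨b, hb⟩

theorem top_ne_bot [Nontrivial A] [SetLike.GradedMonoid 𝒜] (hφ : IsOrientation 𝒜 s φ)
    (htop : ⨆ k, 𝒜 k = ⊤) : 𝒜 s ≠ ⊥ := by
  intro hbot
  refine one_ne_zero (hφ.eq_zero_of_forall_mul htop (zero_add s) SetLike.GradedOne.one_mem ?_)
  rintro b hb
  rw [hbot, Submodule.mem_bot] at hb
  rw [hb, mul_zero, map_zero]

theorem bijOn_mul_of_injective [SetLike.GradedMonoid 𝒜] [Module.Finite K A]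
    (hφ : IsOrientation 𝒜 s φ) (htop : ⨆ k, 𝒜 k = ⊤) {d k m : ℕ} (hkm : k + m = s)
    (hdk : d + k = m) {x : A} (hx : x ∈ 𝒜 d) (h : ∀ a ∈ 𝒜 k, x * a = 0 → a = 0) :
    Set.BijOn (fun a => x * a) (𝒜 k : Set A) (𝒜 m : Set A) := by
  have hmaps : ∀ a ∈ 𝒜 k, LinearMap.mulLeft K x a ∈ 𝒜 m :=
    fun a ha => hdk ▸ SetLike.mul_mem_graded hx ha
  have hinj : Function.Injective ((LinearMap.mulLeft K x).restrict hmaps) := by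
    rw [injective_iff_map_eq_zero]
    exact fun a ha => Subtype.ext (h a a.2 (congrArg Subtype.val ha))
  have hfinrank : Module.finrank K (𝒜 k) = Module.finrank K (𝒜 m) :=
    (hφ.finrank_le htop hkm).antisymm (hφ.finrank_le htop ((add_comm m k).trans hkm))
  have hsurj := (LinearMap.injective_iff_surjective_of_finrank_eq_finrank hfinrank).1 hinj
  refine ⟨hmaps, fun a ha b hb hab => ?_, fun c hc => ?_⟩
  · exact congrArg Subtype.val (@hinj ⟨a, ha⟩ ⟨b, hb⟩ (Subtype.ext hab))
  · obtain ⟨a, ha⟩ := hsurj ⟨c, hc⟩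
    exact ⟨a, a.2, congrArg Subtype.val ha⟩

theorem isStrongLefschetzElement [SetLike.GradedMonoid 𝒜] [Module.Finite K A]
    (hφ : IsOrientation 𝒜 s φ) (htop : ⨆ k, 𝒜 k = ⊤) {L : A} (hL : L ∈ 𝒜 1)
    (h : ∀ k, 2 * k < s → ∀ a ∈ 𝒜 k, (∀ b ∈ 𝒜 k, φ (L ^ (s - 2 * k) * (a * b)) = 0) → a = 0) :
    IsStrongLefschetzElement 𝒜 s L where
  mem := hL
  bij k hk := by
    have hpow : L ^ (s - 2 * k) ∈ 𝒜 (s - 2 * k) := by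
      simpa using SetLike.pow_mem_graded (s - 2 * k) hL
    refine hφ.bijOn_mul_of_injective htop (by lia) (by lia) hpow fun a ha hLa => ?_
    obtain hk | hk := hk.lt_or_eq
    · exact h k hk a ha fun b _ => by rw [← mul_assoc, hLa, zero_mul, map_zero]
    · simpa [hk] using hLa

end IsOrientation

end GradedDuality

section QuotientGrading

variable {σ K : Type*} [Field K] {I : Ideal (MvPolynomial σ K)}

theorem mk_mem_quotientGrading {P : MvPolynomial σ K} {k : ℕ} (hP : P.IsHomogeneous k) :
    Ideal.Quotient.mk I P ∈ quotientGrading I k :=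
  ⟨P, hP, rfl⟩

theorem quotientGrading_gradedMonoid (I : Ideal (MvPolynomial σ K)) :
    SetLike.GradedMonoid (quotientGrading I) where
  one_mem := mk_mem_quotientGrading (isHomogeneous_one σ K)
  mul_mem := by
    rintro i j _ _ ⟨P, hP, rfl⟩ ⟨Q, hQ, rfl⟩
    exact mk_mem_quotientGrading (hP.mul hQ)

theorem iSup_quotientGrading (I : Ideal (MvPolynomial σ K)) : ⨆ k, quotientGrading I k = ⊤ := by
  refine eq_top_iff.2 fun a _ => ?_
  obtain ⟨P, rfl⟩ := Ideal.Quotient.mk_surjective a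
  rw [← sum_homogeneousComponent P, map_sum]
  exact Submodule.sum_mem _ fun k _ => Submodule.mem_iSup_of_mem k
    (mk_mem_quotientGrading (homogeneousComponent_isHomogeneous k P))

theorem quotientGrading_isInternal (hI : ∀ P ∈ I, ∀ k, homogeneousComponent k P ∈ I) :
    DirectSum.IsInternal (quotientGrading I) := by
  refine (DirectSum.isInternal_submodule_iff_iSupIndep_and_iSup_eq_top _).2
    ⟨fun k => Submodule.disjoint_def.2 fun a ha hsup => ?_, iSup_quotientGrading I⟩
  let proj : (MvPolynomial σ K ⧸ I) →ₗ[K] MvPolynomial σ K ⧸ I :=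
    (I.restrictScalars K).mapQ (I.restrictScalars K) (homogeneousComponent k) fun P hP => hI P hP k
  have hker : ⨆ j ≠ k, quotientGrading I j ≤ LinearMap.ker proj := by
    refine iSup₂_le fun j hj => ?_
    rintro _ ⟨P, hP, rfl⟩
    change Ideal.Quotient.mk I (homogeneousComponent k P) = 0
    rw [homogeneousComponent_of_mem hP, if_neg hj.symm, map_zero]
  obtain ⟨P, hP, rfl⟩ := ha
  have hproj : proj (Ideal.Quotient.mk I P) = Ideal.Quotient.mk I (homogeneousComponent k P) := rfl
  rw [homogeneousComponent_eq_self hP] at hproj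
  exact hproj.symm.trans (hker hsup)

end QuotientGrading

section ApolarAlgebra

variable {σ K : Type*} [Field K]

/-- The embedding `P ↦ P(∂/∂x) F` of `K[x] / Ann(F)` into `K[x]`. -/
noncomputable def apolarMap (F : MvPolynomial σ K) :
    (MvPolynomial σ K ⧸ diffAnn F) →ₗ[K] MvPolynomial σ K :=
  ((diffAnn F).restrictScalars K).liftQ
    ((LinearMap.applyₗ F).comp (diffOp σ K).toLinearMap) fun _ h => h

theorem mk_diffAnn_eq_zero_iff {F P : MvPolynomial σ K} :
    Ideal.Quotient.mk (diffAnn F) P = 0 ↔ diffOp σ K P F = 0 :=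
  Ideal.Quotient.eq_zero_iff_mem

theorem apolarMap_injective (F : MvPolynomial σ K) : Function.Injective (apolarMap F) := by
  refine (injective_iff_map_eq_zero _).2 fun a ha => ?_
  obtain ⟨P, rfl⟩ := Ideal.Quotient.mk_surjective a
  exact mk_diffAnn_eq_zero_iff.2 ha

theorem finite_quotient_diffAnn [Finite σ] (F : MvPolynomial σ K) :
    Module.Finite K (MvPolynomial σ K ⧸ diffAnn F) := by
  have hrange : ∀ a, apolarMap F a ∈ restrictTotalDegree σ K F.totalDegree := fun a => by
    obtain ⟨P, rfl⟩ := Ideal.Quotient.mk_surjective a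
    exact (mem_restrictTotalDegree _ _ _).2 (totalDegree_diffOp_le P F)
  exact .of_injective ((apolarMap F).codRestrict _ hrange)
    ((LinearMap.injective_codRestrict_iff _).2 (apolarMap_injective F))

theorem nontrivial_quotient_diffAnn {F : MvPolynomial σ K} (hF : F ≠ 0) :
    Nontrivial (MvPolynomial σ K ⧸ diffAnn F) := by
  refine Ideal.Quotient.nontrivial_iff.2 ((Ideal.ne_top_iff_one _).2 fun h => hF ?_)
  have h1 : diffOp σ K 1 F = 0 := h
  rwa [map_one, Module.End.one_apply] at h1

theorem isNilpotent_mk_of_coeff_zero_eq_zero (F : MvPolynomial σ K) {P : MvPolynomial σ K}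
    (hP : coeff 0 P = 0) : IsNilpotent (Ideal.Quotient.mk (diffAnn F) P) := by
  have hmem : P ∈ idealOfVars σ K := by
    rw [← pow_one (idealOfVars σ K), mem_pow_idealOfVars_iff']
    intro b hb
    rwa [(Finsupp.degree_eq_zero_iff b).1 (Nat.lt_one_iff.1 hb)]
  refine ⟨F.totalDegree + 1, ?_⟩
  rw [← map_pow, mk_diffAnn_eq_zero_iff]
  exact diffOp_eq_zero_of_totalDegree_lt
    ((mem_pow_idealOfVars_iff _ _).1 (Ideal.pow_mem_pow hmem (F.totalDegree + 1)))

theorem exists_isNilpotent_sub_algebraMap (F : MvPolynomial σ K)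
    (a : MvPolynomial σ K ⧸ diffAnn F) : ∃ c : K, IsNilpotent (a - algebraMap K _ c) := by
  obtain ⟨P, rfl⟩ := Ideal.Quotient.mk_surjective a
  refine ⟨coeff 0 P, ?_⟩
  have := isNilpotent_mk_of_coeff_zero_eq_zero F (P := P - C (coeff 0 P)) (by simp)
  rwa [map_sub] at this

/-- The functional `P ↦ (P(∂/∂x) F)(0)` on `K[x] / Ann(F)`. -/
noncomputable def apolarFunctional (F : MvPolynomial σ K) :
    (MvPolynomial σ K ⧸ diffAnn F) →ₗ[K] K :=
  lcoeff K 0 ∘ₗ apolarMap F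

theorem apolarFunctional_mk (F P : MvPolynomial σ K) :
    apolarFunctional F (Ideal.Quotient.mk (diffAnn F) P) = coeff 0 (diffOp σ K P F) :=
  rfl

theorem apolarFunctional_separatingLeft [CharZero K] (F : MvPolynomial σ K) :
    ((LinearMap.mul K _).compr₂ (apolarFunctional F)).SeparatingLeft := by
  intro a ha
  obtain ⟨P, rfl⟩ := Ideal.Quotient.mk_surjective a
  refine mk_diffAnn_eq_zero_iff.2 (eq_zero_of_forall_coeff_zero_diffOp fun Q => ?_)
  rw [← diffOp_mul_apply, mul_comm, ← apolarFunctional_mk, map_mul]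
  exact ha _

theorem isArtinianGorenstein_quotient_diffAnn [CharZero K] [Finite σ] {F : MvPolynomial σ K}
    (hF : F ≠ 0) : IsArtinianGorenstein (MvPolynomial σ K ⧸ diffAnn F) := by
  have := finite_quotient_diffAnn F
  have := nontrivial_quotient_diffAnn hF
  have := IsArtinianRing.of_finite K (MvPolynomial σ K ⧸ diffAnn F)
  exact isArtinianGorenstein_of_separatingLeft (exists_isNilpotent_sub_algebraMap F)
    (apolarFunctional F) (apolarFunctional_separatingLeft F)

variable {F : MvPolynomial σ K} {s : ℕ}

theorem homogeneousComponent_mem_diffAnn (hF : F.IsHomogeneous s) {P : MvPolynomial σ K}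
    (hP : P ∈ diffAnn F) (k : ℕ) : homogeneousComponent k P ∈ diffAnn F := by
  obtain hk | hk := le_or_gt k s
  · exact (homogeneousComponent_diffOp hF hk P).symm.trans
      ((congrArg _ hP).trans (map_zero _))
  · exact diffOp_eq_zero_of_isHomogeneous (homogeneousComponent_isHomogeneous k P) hF hk

theorem quotientGrading_diffAnn_eq_bot (hF : F.IsHomogeneous s) {k : ℕ} (hk : s < k) :
    quotientGrading (diffAnn F) k = ⊥ := by
  rw [eq_bot_iff]
  rintro _ ⟨P, hP, rfl⟩
  exact mk_diffAnn_eq_zero_iff.2 (diffOp_eq_zero_of_isHomogeneous hP hF hk)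

theorem isOrientation_apolarFunctional [CharZero K] (hF : F.IsHomogeneous s) :
    IsOrientation (quotientGrading (diffAnn F)) s (apolarFunctional F) where
  eq_zero_of_ne := by
    rintro k hk _ ⟨P, hP, rfl⟩
    by_contra hne
    obtain ⟨b, hbP, hbF⟩ := exists_mem_support_of_mem_support_diffOp (mem_support_iff.2 hne)
    rw [add_zero] at hbF
    exact hk ((hP (mem_support_iff.1 hbP)).symm.trans (hF (mem_support_iff.1 hbF)))
  separatingLeft := apolarFunctional_separatingLeft F

theorem isGradedArtinian_quotient_diffAnn [CharZero K] [Finite σ] (hF : F.IsHomogeneous s)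
    (hF0 : F ≠ 0) : IsGradedArtinian (quotientGrading (diffAnn F)) s where
  artinian := (isArtinianGorenstein_quotient_diffAnn hF0).1
  graded := quotientGrading_gradedMonoid _
  internal := quotientGrading_isInternal fun _ => homogeneousComponent_mem_diffAnn hF
  top_ne :=
    have := nontrivial_quotient_diffAnn hF0
    have := quotientGrading_gradedMonoid (diffAnn F)
    (isOrientation_apolarFunctional hF).top_ne_bot (iSup_quotientGrading _)
  eq_bot _ := quotientGrading_diffAnn_eq_bot hF

end ApolarAlgebra

section Lefschetz

variable {σ K : Type*} [Field K]

theorem coeff_zero_diffOp_pow_sum_C_mul_X [Fintype σ] (a : σ → K) {G : MvPolynomial σ K} {d : ℕ}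
    (hG : G.IsHomogeneous d) :
    coeff 0 (diffOp σ K ((∑ i, C (a i) * X i) ^ d) G) = d.factorial * eval a G := by
  induction d generalizing G with
  | zero =>
    rw [← totalDegree_zero_iff_isHomogeneous, totalDegree_eq_zero_iff_eq_C] at hG
    rw [hG]
    simp
  | succ d ih =>
    have hdiff : diffOp σ K (∑ i, C (a i) * X i) G = ∑ i, C (a i) * pderiv i G := by
      simp only [map_sum, LinearMap.sum_apply, C_mul', map_smul, LinearMap.smul_apply,
        diffOp_X_apply]
    have hhom : (∑ i, C (a i) * pderiv i G).IsHomogeneous d :=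
      IsHomogeneous.sum _ _ _ fun i _ => hG.pderiv.C_mul (a i)
    have heuler : ∑ i, a i * eval a (pderiv i G) = (d + 1 : ℕ) * eval a G := by
      simpa using congrArg (eval a) hG.sum_X_mul_pderiv
    rw [pow_succ, diffOp_mul_apply, hdiff, ih hhom, map_sum]
    simp only [map_mul, eval_C]
    rw [heuler, Nat.factorial_succ]
    push_cast
    ring

/-- The Hessian matrix of `F` evaluated at the point `a`. -/
noncomputable def hessianMatrix {σ R : Type*} [CommSemiring R] (F : MvPolynomial σ R) (a : σ → R) :
    Matrix σ σ R :=
  .of fun i j => eval a (pderiv i (pderiv j F))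

theorem eq_zero_of_det_hessianMatrix_ne_zero [Fintype σ] [DecidableEq σ]
    {F : MvPolynomial σ K} {a : σ → K} (hdet : (hessianMatrix F a).det ≠ 0)
    {P : MvPolynomial σ K} (hP : P.IsHomogeneous 1)
    (h : ∀ i, eval a (diffOp σ K (P * X i) F) = 0) : P = 0 := by
  have hspan : P ∈ Submodule.span K (Set.range (X : σ → MvPolynomial σ K)) :=
    homogeneousSubmodule_one_eq_span_X (σ := σ) (R := K) ▸ hP
  obtain ⟨v, rfl⟩ := (Submodule.mem_span_range_iff_exists_fun K).1 hspan
  have hv : v = 0 := by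
    by_contra hv
    refine hdet (Matrix.exists_vecMul_eq_zero_iff.1 ⟨v, hv, funext fun i => ?_⟩)
    have hi := h i
    simp only [diffOp_mul_apply, diffOp_X_apply, map_sum, map_smul, LinearMap.sum_apply,
      LinearMap.smul_apply, smul_eval] at hi
    exact hi
  simp [hv]

variable [CharZero K] [Fintype σ] {F : MvPolynomial σ K} {s : ℕ}

/-- The Maeno–Watanabe criterion: multiplication by `L ^ (s - 2 * k)` from degree `k` to degree
`s - k` is injective as soon as the `k`-th Hessian form of `F` at `a` is nondegenerate. -/
theorem isStrongLefschetzElement_of_hessianForm (hF : F.IsHomogeneous s) (a : σ → K)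
    (h : ∀ k, 2 * k < s → ∀ P : MvPolynomial σ K, P.IsHomogeneous k →
      (∀ Q : MvPolynomial σ K, Q.IsHomogeneous k → eval a (diffOp σ K (P * Q) F) = 0) →
        diffOp σ K P F = 0) :
    IsStrongLefschetzElement (quotientGrading (diffAnn F)) s
      (Ideal.Quotient.mk _ (∑ i, C (a i) * X i)) := by
  have := finite_quotient_diffAnn F
  have := quotientGrading_gradedMonoid (diffAnn F)
  refine (isOrientation_apolarFunctional hF).isStrongLefschetzElement (iSup_quotientGrading _)
    (mk_mem_quotientGrading (IsHomogeneous.sum _ _ _ fun i _ => (isHomogeneous_X K i).C_mul _)) ?_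
  rintro k hk _ ⟨P, hP, rfl⟩ hPQ
  refine mk_diffAnn_eq_zero_iff.2 (h k hk P hP fun Q hQ => ?_)
  have hhom : (diffOp σ K (P * Q) F).IsHomogeneous (s - 2 * k) :=
    two_mul k ▸ diffOp_isHomogeneous (hP.mul hQ) hF
  have hpair := hPQ _ (mk_mem_quotientGrading hQ)
  change coeff 0 (diffOp σ K ((∑ i, C (a i) * X i) ^ (s - 2 * k) * (P * Q)) F) = 0 at hpair
  rw [diffOp_mul_apply, coeff_zero_diffOp_pow_sum_C_mul_X a hhom] at hpair
  exact (mul_eq_zero.1 hpair).resolve_left (Nat.cast_ne_zero.2 (Nat.factorial_ne_zero _))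

theorem isStrongLefschetzElement_of_det_hessianMatrix_ne_zero [DecidableEq σ]
    (hF : F.IsHomogeneous s) (hs : s ≤ 4) {a : σ → K} (ha : eval a F ≠ 0)
    (hdet : 3 ≤ s → (hessianMatrix F a).det ≠ 0) :
    IsStrongLefschetzElement (quotientGrading (diffAnn F)) s
      (Ideal.Quotient.mk _ (∑ i, C (a i) * X i)) := by
  refine isStrongLefschetzElement_of_hessianForm hF a fun k hk P hP hPQ => ?_
  obtain rfl | rfl : k = 0 ∨ k = 1 := by lia
  · obtain ⟨c, rfl⟩ : ∃ c, P = C c :=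
      ⟨_, totalDegree_eq_zero_iff_eq_C.1 ((totalDegree_zero_iff_isHomogeneous _).2 hP)⟩
    have hc := hPQ 1 (isHomogeneous_one σ K)
    rw [mul_one, ← algebraMap_eq, AlgHom.commutes, Module.algebraMap_end_apply, smul_eval] at hc
    rw [(mul_eq_zero.1 hc).resolve_right ha, map_zero, map_zero, LinearMap.zero_apply]
  · rw [eq_zero_of_det_hessianMatrix_ne_zero (hdet hk) hP
      fun i => hPQ _ (isHomogeneous_X K i), map_zero, LinearMap.zero_apply]

end Lefschetz

open SimpleGraph

section SpanningTrees

variable {V : Type*} {G : SimpleGraph V}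

theorem edgeSet_fromEdgeSet_image_val (T : Set G.edgeSet) :
    (fromEdgeSet (Subtype.val '' T)).edgeSet = Subtype.val '' T := by
  rw [edgeSet_fromEdgeSet, sdiff_eq_left, Set.disjoint_left]
  rintro _ ⟨e, -, rfl⟩
  exact G.not_isDiag_of_mem_edgeSet e.2

theorem isSpanningTree_iff [Fintype V] {T : Finset G.edgeSet} :
    IsSpanningTree G T ↔ T.card + 1 = Fintype.card V ∧
      (fromEdgeSet (Subtype.val '' (T : Set G.edgeSet))).Connected := by
  rw [IsSpanningTree, isTree_iff_connected_and_card, edgeSet_fromEdgeSet_image_val,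
    Nat.card_image_of_injective Subtype.val_injective, Nat.card_coe_set_eq, Set.ncard_coe_finset,
    Nat.card_eq_fintype_card, and_comm]

instance [DecidableEq V] (T : Finset G.edgeSet) :
    DecidableRel (fromEdgeSet (Subtype.val '' (T : Set G.edgeSet))).Adj := fun u v =>
  decidable_of_iff ((∃ e ∈ T, e.1 = s(u, v)) ∧ u ≠ v) (by simp)

instance [Fintype V] [DecidableEq V] : DecidablePred (IsSpanningTree G) := fun _ =>
  decidable_of_iff _ isSpanningTree_iff.symm

theorem exists_isSpanningTree [Finite V] (h : G.Connected) : ∃ T, IsSpanningTree G T := by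
  obtain ⟨H, hHG, hH⟩ := h.exists_isTree_le
  have himage : Subtype.val '' (Subtype.val ⁻¹' H.edgeSet : Set G.edgeSet) = H.edgeSet :=
    (Subtype.image_preimage_val _ _).trans (Set.inter_eq_right.2 (edgeSet_mono hHG))
  refine ⟨(Set.toFinite (Subtype.val ⁻¹' H.edgeSet)).toFinset, ?_⟩
  rwa [IsSpanningTree, Set.Finite.coe_toFinset, himage, fromEdgeSet_edgeSet]

theorem isSpanningTree_map_iff {W : Type*} {G' : SimpleGraph W} (φ : G ≃g G')
    {T : Finset G.edgeSet} :
    IsSpanningTree G' (T.map φ.mapEdgeSet.toEmbedding) ↔ IsSpanningTree G T := by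
  refine (Iso.isTree_iff ⟨φ.toEquiv, ?_⟩).symm
  intro u v
  simp only [fromEdgeSet_adj, ne_eq, φ.toEquiv.injective.eq_iff, Finset.coe_map, Set.image_image]
  refine and_congr_left fun _ => ⟨?_, ?_⟩
  · rintro ⟨e, he, h⟩
    exact ⟨e, he, Sym2.map.injective φ.injective h⟩
  · rintro ⟨e, he, h⟩
    exact ⟨e, he, congrArg (Sym2.map φ) h⟩

/-- The number of spanning trees of `G` through the edges `e` and `f`. -/
noncomputable def spanningTreeCount (G : SimpleGraph V) (e f : G.edgeSet) : ℕ :=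
  {T : Finset G.edgeSet | e ∈ T ∧ f ∈ T ∧ IsSpanningTree G T}.ncard

theorem spanningTreeCount_eq_card [Fintype V] [DecidableEq V] [DecidableRel G.Adj]
    (e f : G.edgeSet) :
    spanningTreeCount G e f =
      (Finset.univ.filter fun T => e ∈ T ∧ f ∈ T ∧ IsSpanningTree G T).card := by
  rw [spanningTreeCount, Set.ncard_eq_toFinset_card', Set.toFinset_ofPred]

theorem spanningTreeCount_mapEdgeSet (φ : G ≃g G) (e f : G.edgeSet) :
    spanningTreeCount G (φ.mapEdgeSet e) (φ.mapEdgeSet f) = spanningTreeCount G e f := by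
  let ψ := φ.mapEdgeSet.finsetCongr
  rw [spanningTreeCount, ← Set.ncard_preimage_of_injective_subset_range ψ.injective
    (by simp [ψ.surjective.range_eq]), spanningTreeCount]
  congr 1
  ext T
  simp only [ψ, Set.mem_preimage, Set.mem_ofPred_eq, Equiv.finsetCongr_apply,
    Finset.mem_map_equiv, Equiv.symm_apply_apply, isSpanningTree_map_iff]

end SpanningTrees

section KirchhoffPolynomial

theorem pderiv_prod_X {σ R : Type*} [CommSemiring R] [DecidableEq σ] (i : σ) (T : Finset σ) :
    pderiv i (∏ j ∈ T, (X j : MvPolynomial σ R)) = if i ∈ T then ∏ j ∈ T.erase i, X j else 0 := by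
  nontriviality R
  have hzero {S : Finset σ} (hi : i ∉ S) : pderiv i (∏ j ∈ S, (X j : MvPolynomial σ R)) = 0 :=
    pderiv_eq_zero_of_notMem_vars fun h => hi (by simpa [vars_X] using vars_prod _ h)
  split_ifs with hi
  · rw [← Finset.mul_prod_erase T _ hi, pderiv_mul, pderiv_X_self, one_mul,
      hzero (T.notMem_erase i), mul_zero, add_zero]
  · exact hzero hi

theorem eval_one_pderiv_pderiv_prod_X {σ R : Type*} [CommSemiring R] [DecidableEq σ] (i j : σ)
    (T : Finset σ) :
    eval 1 (pderiv i (pderiv j (∏ k ∈ T, (X k : MvPolynomial σ R)))) =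
      if i ≠ j ∧ i ∈ T ∧ j ∈ T then 1 else 0 := by
  rw [pderiv_prod_X]
  split_ifs with hj hij hij
  · rw [pderiv_prod_X, if_pos (Finset.mem_erase.2 ⟨hij.1, hij.2.1⟩)]
    simp [map_prod]
  · rw [pderiv_prod_X, if_neg (by grind), map_zero]
  · exact absurd hij.2.2 hj
  · rw [map_zero, map_zero]

variable {V : Type*} [Fintype V] {K : Type*} [Field K] {G : SimpleGraph V}

theorem kirchhoffPolynomial_isHomogeneous :
    (kirchhoffPolynomial K G).IsHomogeneous (Fintype.card V - 1) := by
  classical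
  refine IsHomogeneous.sum _ _ _ fun T hT => ?_
  have hcard := (isSpanningTree_iff.1 (by simpa using hT : IsSpanningTree G T)).1
  rw [← hcard, Nat.add_sub_cancel, Finset.card_eq_sum_ones]
  exact IsHomogeneous.prod T _ _ fun e _ => isHomogeneous_X K e

theorem eval_one_kirchhoffPolynomial_ne_zero [CharZero K] (hG : G.Connected) :
    eval 1 (kirchhoffPolynomial K G) ≠ 0 := by
  classical
  obtain ⟨T, hT⟩ := exists_isSpanningTree hG
  simp only [kirchhoffPolynomial, map_sum, map_prod, eval_X, Pi.one_apply, Finset.prod_const_one,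
    Finset.sum_const, nsmul_one, ne_eq, Nat.cast_eq_zero, Finset.card_eq_zero]
  exact Finset.Nonempty.ne_empty ⟨T, by simpa using hT⟩

theorem kirchhoffPolynomial_ne_zero [CharZero K] (hG : G.Connected) :
    kirchhoffPolynomial K G ≠ 0 := fun h =>
  eval_one_kirchhoffPolynomial_ne_zero (K := K) hG (h ▸ map_zero _)

theorem hessianMatrix_kirchhoffPolynomial_one [DecidableEq V] :
    hessianMatrix (kirchhoffPolynomial K G) 1 =
      .of fun e f => if e = f then 0 else (spanningTreeCount G e f : K) := by
  classical
  ext e f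
  simp only [hessianMatrix, Matrix.of_apply, kirchhoffPolynomial, map_sum,
    eval_one_pderiv_pderiv_prod_X, Finset.sum_boole, Finset.filter_filter]
  split_ifs with hef
  · simp [hef]
  · rw [spanningTreeCount_eq_card]
    congr 2
    ext T
    simp only [Finset.mem_filter_univ]
    tauto

end KirchhoffPolynomial

section GraphicAlgebra

variable {V : Type*} [Fintype V] {K : Type*} [Field K] [CharZero K] {G : SimpleGraph V}

theorem isArtinianGorenstein_graphicAlgebra (hG : G.Connected) :
    IsArtinianGorenstein (GraphicAlgebra K G) :=
  isArtinianGorenstein_quotient_diffAnn (kirchhoffPolynomial_ne_zero hG)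

theorem isGradedArtinian_graphicGrading (hG : G.Connected) :
    IsGradedArtinian (graphicGrading K G) (Fintype.card V - 1) :=
  isGradedArtinian_quotient_diffAnn kirchhoffPolynomial_isHomogeneous
    (kirchhoffPolynomial_ne_zero hG)

theorem isStrongLefschetzElement_edgeSum [Fintype G.edgeSet] [DecidableEq G.edgeSet]
    (hG : G.Connected) (hV : Fintype.card V ≤ 5)
    (hdet : 4 ≤ Fintype.card V → (hessianMatrix (kirchhoffPolynomial K G) 1).det ≠ 0) :
    IsStrongLefschetzElement (graphicGrading K G) (Fintype.card V - 1) (edgeSum K G) := by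
  have h := isStrongLefschetzElement_of_det_hessianMatrix_ne_zero kirchhoffPolynomial_isHomogeneous
    (by lia) (eval_one_kirchhoffPolynomial_ne_zero hG) fun hs => hdet (by lia)
  simp only [Pi.one_apply, map_one, one_mul] at h
  convert! h using 1
  unfold edgeSum
  congr!

end GraphicAlgebra

open scoped Matrix

section EdgeIncidence

variable {V R : Type*} [DecidableEq V] {G : SimpleGraph V} [DecidableRel G.Adj]

/-- The vertex-edge incidence matrix of `G`: Mathlib's `SimpleGraph.incMatrix` with the columns
restricted from all of `Sym2 V` to the edges of `G`. -/
def edgeIncMatrix (R : Type*) [Zero R] [One R] (G : SimpleGraph V) [DecidableRel G.Adj] :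
    Matrix V G.edgeSet R :=
  (G.incMatrix R).submatrix id Subtype.val

theorem edgeIncMatrix_apply [Zero R] [One R] (v : V) (e : G.edgeSet) :
    edgeIncMatrix R G v e = if v ∈ e.1 then 1 else 0 := by
  simp [edgeIncMatrix, incMatrix_apply', incidenceSet]

theorem sum_edgeSet_eq_sum {V M : Type*} [Fintype (Sym2 V)] [AddCommMonoid M]
    {G : SimpleGraph V} [Fintype G.edgeSet] {f : Sym2 V → M} (hf : ∀ e ∉ G.edgeSet, f e = 0) :
    ∑ e : G.edgeSet, f e = ∑ e, f e := by
  rw [Finset.sum_set_coe]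
  exact Finset.sum_subset (Finset.subset_univ _) fun e _ he => hf e (by simpa using he)

variable [Fintype V]

theorem sum_edgeIncMatrix_apply [NonAssocSemiring R] (e : G.edgeSet) :
    ∑ v, edgeIncMatrix R G v e = 2 :=
  G.sum_incMatrix_apply_of_mem_edgeSet e.2

theorem one_vecMul_edgeIncMatrix [NonAssocSemiring R] : 1 ᵥ* edgeIncMatrix R G = 2 := by
  ext e
  rw [Matrix.vecMul, one_dotProduct, sum_edgeIncMatrix_apply, Pi.ofNat_apply]

theorem edgeIncMatrix_mulVec_one [NonAssocSemiring R] :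
    edgeIncMatrix R G *ᵥ 1 = fun v => (G.degree v : R) := by
  ext v
  rw [Matrix.mulVec, dotProduct_one, ← sum_incMatrix_apply]
  exact sum_edgeSet_eq_sum (f := G.incMatrix R v) fun _ he =>
    G.incMatrix_of_notMem_incidenceSet fun h => he h.1

theorem edgeIncMatrix_mul_transpose [Semiring R] :
    edgeIncMatrix R G * (edgeIncMatrix R G)ᵀ =
      .of fun u v => if u = v then (G.degree u : R) else if G.Adj u v then 1 else 0 := by
  rw [← incMatrix_mul_transpose]
  ext u v
  refine sum_edgeSet_eq_sum (f := fun e => G.incMatrix R u e * G.incMatrix R v e) fun e he => ?_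
  rw [G.incMatrix_of_notMem_incidenceSet fun h => he h.1, zero_mul]

theorem edgeIncMatrix_transpose_mul_apply [NonAssocSemiring R] (e f : G.edgeSet) :
    ((edgeIncMatrix R G)ᵀ * edgeIncMatrix R G) e f =
      if e = f then 2 else if ∃ v ∈ e.1, v ∈ f.1 then 1 else 0 := by
  have hsum : ((edgeIncMatrix R G)ᵀ * edgeIncMatrix R G) e f =
      ∑ v, if v ∈ e.1 ∧ v ∈ f.1 then 1 else 0 := by
    simp [Matrix.mul_apply, edgeIncMatrix_apply, ← ite_and, and_comm]
  rw [hsum]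
  split_ifs with hef hv
  · simp [hef, ← edgeIncMatrix_apply (R := R), sum_edgeIncMatrix_apply]
  · obtain ⟨v, he, hf⟩ := hv
    rw [Finset.sum_eq_single v]
    · simp [he, hf]
    · intro w _ hw
      refine if_neg fun h => hef (Subtype.ext ?_)
      exact Sym2.eq_of_ne_mem hw h.1 he h.2 hf
    · simp
  · exact Finset.sum_eq_zero fun v _ => if_neg fun h => hv ⟨v, h⟩

theorem edgeIncMatrix_completeGraph_mul_transpose [Nonempty V] [Ring R] :
    edgeIncMatrix R (completeGraph V) * (edgeIncMatrix R (completeGraph V))ᵀ =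
      ((Fintype.card V : R) - 2) • 1 + Matrix.vecMulVec 1 1 := by
  ext u v
  rw [edgeIncMatrix_mul_transpose]
  by_cases huv : u = v
  · subst huv
    have hcard : (Fintype.card V : R) - 2 + 1 = Fintype.card V - 1 := by rw [sub_add]; norm_num
    simp [Nat.cast_sub Fintype.card_pos, hcard]
  · simp [huv]

/-- The three scalars are the eigenvalues of the matrix: on the kernel of the incidence matrix, on
the vectors `Nᵀ u` with `∑ v, u v = 0`, and on the constant vectors. -/
theorem det_one_add_gram_add_vecMulVec_one_completeGraph_ne_zero {K : Type*} [Field K]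
    [Nonempty V] {α β γ : K} (hα : α ≠ 0)
    (hαβ : α + (Fintype.card V - 2) * β ≠ 0)
    (hαβγ : α + 2 * (Fintype.card V - 1) * β + (Fintype.card V).choose 2 * γ ≠ 0) :
    (α • 1 + β • ((edgeIncMatrix K (completeGraph V))ᵀ * edgeIncMatrix K (completeGraph V)) +
      γ • Matrix.vecMulVec 1 1).det ≠ 0 := by
  set N := edgeIncMatrix K (completeGraph V)
  intro hdet
  obtain ⟨x, hx, hMx⟩ := Matrix.exists_mulVec_eq_zero_iff.2 hdet
  have hsum_mulVec : 1 ⬝ᵥ N *ᵥ x = 2 * (1 ⬝ᵥ x) := by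
    rw [Matrix.dotProduct_mulVec, one_vecMul_edgeIncMatrix]
    simp [dotProduct, Finset.mul_sum]
  have hsum_transpose_mulVec :
      1 ⬝ᵥ Nᵀ *ᵥ N *ᵥ x = (Fintype.card V - 1) * (1 ⬝ᵥ N *ᵥ x) := by
    rw [Matrix.dotProduct_mulVec, Matrix.vecMul_transpose, edgeIncMatrix_mulVec_one]
    simp [dotProduct, Finset.mul_sum, Nat.cast_sub Fintype.card_pos]
  have hrow : α • x + β • (Nᵀ *ᵥ N *ᵥ x) + (γ * (1 ⬝ᵥ x)) • 1 = 0 := by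
    simpa only [Matrix.add_mulVec, Matrix.smul_mulVec, Matrix.one_mulVec, ← Matrix.mulVec_mulVec,
      Matrix.vecMulVec_mulVec, op_smul_eq_smul, smul_smul] using hMx
  have hcard : (1 : (completeGraph V).edgeSet → K) ⬝ᵥ 1 = (Fintype.card V).choose 2 := by
    rw [one_dotProduct_one, ← edgeFinset_card, card_edgeFinset_top_eq_card_choose_two]
  have hx0 : 1 ⬝ᵥ x = 0 := by
    have h := congrArg (1 ⬝ᵥ ·) hrow
    simp only [dotProduct_add, dotProduct_smul, hsum_transpose_mulVec, hsum_mulVec, hcard,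
      smul_eq_mul, dotProduct_zero] at h
    exact (mul_eq_zero.1 (by linear_combination h)).resolve_left hαβγ
  have hNx0 : N *ᵥ x = 0 := by
    have h := congrArg (N *ᵥ ·) hrow
    simp only [Matrix.mulVec_add, Matrix.mulVec_smul, Matrix.mulVec_zero, hx0, mul_zero,
      zero_smul, add_zero] at h
    rw [Matrix.mulVec_mulVec (N *ᵥ x), edgeIncMatrix_completeGraph_mul_transpose,
      Matrix.add_mulVec, Matrix.vecMulVec_mulVec, hsum_mulVec, hx0, mul_zero, op_smul_eq_smul,
      zero_smul, add_zero, Matrix.smul_mulVec, Matrix.one_mulVec, smul_smul, ← add_smul,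
      mul_comm β] at h
    exact (smul_eq_zero.1 h).resolve_left hαβ
  rw [hNx0, hx0] at hrow
  simp [hα, hx] at hrow

theorem hessianMatrix_kirchhoffPolynomial_one_eq_of_spanningTreeCount {K : Type*} [Field K]
    {a b : ℕ}
    (hadj : ∀ e f : G.edgeSet, e ≠ f → ∀ v ∈ e.1, v ∈ f.1 → spanningTreeCount G e f = a)
    (hdisj : ∀ e f : G.edgeSet, (∀ v ∈ e.1, v ∉ f.1) → spanningTreeCount G e f = b) :
    hessianMatrix (kirchhoffPolynomial K G) 1 =
      (b - 2 * a : K) • 1 + (a - b : K) • ((edgeIncMatrix K G)ᵀ * edgeIncMatrix K G) +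
        (b : K) • Matrix.vecMulVec 1 1 := by
  ext e f
  simp only [hessianMatrix_kirchhoffPolynomial_one, Matrix.of_apply, Matrix.add_apply,
    Matrix.smul_apply, Matrix.one_apply, edgeIncMatrix_transpose_mul_apply, Matrix.vecMulVec_apply,
    Pi.one_apply, smul_eq_mul]
  split_ifs with hef hv
  · ring
  · obtain ⟨v, he, hf⟩ := hv
    rw [hadj e f hef v he hf]
    ring
  · rw [hdisj e f fun v he hf => hv ⟨v, he, hf⟩]
    ring

end EdgeIncidence

section CompleteGraph

variable {V : Type*}

theorem exists_embedding_of_adjacent {e f : (completeGraph V).edgeSet} (hef : e ≠ f) {v : V}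
    (he : v ∈ e.1) (hf : v ∈ f.1) :
    ∃ x : Fin 3 ↪ V, e.1 = s(x 0, x 1) ∧ f.1 = s(x 0, x 2) := by
  obtain ⟨_, hea⟩ := e
  obtain ⟨_, hfb⟩ := f
  obtain ⟨a, rfl⟩ := he
  obtain ⟨b, rfl⟩ := hf
  have hva : v ≠ a := hea
  have hvb : v ≠ b := hfb
  have hab : a ≠ b := fun h => hef (by simp only [h])
  exact ⟨⟨![v, a, b], List.nodup_ofFn.1 (by simp [hva, hvb, hab])⟩, rfl, rfl⟩

theorem exists_embedding_of_disjoint {e f : (completeGraph V).edgeSet}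
    (hef : ∀ v ∈ e.1, v ∉ f.1) :
    ∃ x : Fin 4 ↪ V, e.1 = s(x 0, x 1) ∧ f.1 = s(x 2, x 3) := by
  obtain ⟨⟨a, b⟩, hab⟩ := e
  obtain ⟨⟨c, d⟩, hcd⟩ := f
  have hab : a ≠ b := hab
  have hcd : c ≠ d := hcd
  have ha : ¬ (a = c ∨ a = d) := fun h => hef a (Sym2.mem_mk_left a b) (Sym2.mem_iff.2 h)
  have hb : ¬ (b = c ∨ b = d) := fun h => hef b (Sym2.mem_mk_right a b) (Sym2.mem_iff.2 h)
  exact ⟨⟨![a, b, c, d], List.nodup_ofFn.1 (by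
    simp [hab, hcd, not_or.1 ha, not_or.1 hb])⟩, rfl, rfl⟩

theorem spanningTreeCount_completeGraph_congr {k : ℕ} (x y : Fin k ↪ V) {i j i' j' : Fin k}
    {e f e' f' : (completeGraph V).edgeSet} (he : e.1 = s(x i, x j)) (hf : f.1 = s(x i', x j'))
    (he' : e'.1 = s(y i, y j)) (hf' : f'.1 = s(y i', y j')) :
    spanningTreeCount (completeGraph V) e f = spanningTreeCount (completeGraph V) e' f' := by
  obtain ⟨π, hπ⟩ := (Equiv.Perm.isMultiplyPretransitive V k).exists_smul_eq x y
  have hπ (l : Fin k) : π (x l) = y l := DFunLike.congr_fun hπ l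
  rw [← spanningTreeCount_mapEdgeSet (Iso.completeGraph π) e f]
  congr 1 <;> refine Subtype.ext ?_
  · rw [he', ← hπ, ← hπ]
    exact congrArg (Sym2.map π) he
  · rw [hf', ← hπ, ← hπ]
    exact congrArg (Sym2.map π) hf

theorem spanningTreeCount_completeGraph_eq_of_adjacent {e f e' f' : (completeGraph V).edgeSet}
    {v v' : V} (hef : e ≠ f) (he : v ∈ e.1) (hf : v ∈ f.1) (hef' : e' ≠ f') (he' : v' ∈ e'.1)
    (hf' : v' ∈ f'.1) :
    spanningTreeCount (completeGraph V) e f = spanningTreeCount (completeGraph V) e' f' := by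
  obtain ⟨x, hx, hx'⟩ := exists_embedding_of_adjacent hef he hf
  obtain ⟨y, hy, hy'⟩ := exists_embedding_of_adjacent hef' he' hf'
  exact spanningTreeCount_completeGraph_congr x y hx hx' hy hy'

theorem spanningTreeCount_completeGraph_eq_of_disjoint {e f e' f' : (completeGraph V).edgeSet}
    (hef : ∀ v ∈ e.1, v ∉ f.1) (hef' : ∀ v ∈ e'.1, v ∉ f'.1) :
    spanningTreeCount (completeGraph V) e f = spanningTreeCount (completeGraph V) e' f' := by
  obtain ⟨x, hx, hx'⟩ := exists_embedding_of_disjoint hef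
  obtain ⟨y, hy, hy'⟩ := exists_embedding_of_disjoint hef'
  exact spanningTreeCount_completeGraph_congr x y hx hx' hy hy'

/-- In `Kₙ` with `n ≥ 4`, two adjacent edges lie in `3 * n ^ (n - 4)` common spanning trees and two
disjoint edges in `4 * n ^ (n - 4)`, hence the ratio. -/
theorem det_hessianMatrix_kirchhoffPolynomial_completeGraph_ne_zero_of_spanningTreeCount
    [Fintype V] [DecidableEq V] (K : Type*) [Field K] [CharZero K] {k : ℕ} (hk : k ≠ 0)
    {e f e' f' : (completeGraph V).edgeSet} {v : V} (hef : e ≠ f) (he : v ∈ e.1) (hf : v ∈ f.1)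
    (hadj : spanningTreeCount (completeGraph V) e f = 3 * k) (hef' : ∀ v ∈ e'.1, v ∉ f'.1)
    (hdisj : spanningTreeCount (completeGraph V) e' f' = 4 * k) :
    (hessianMatrix (kirchhoffPolynomial K (completeGraph V)) 1).det ≠ 0 := by
  have : Nonempty V := ⟨v⟩
  obtain ⟨m, hm⟩ : ∃ m, Fintype.card V = m + 4 := by
    obtain ⟨x, -⟩ := exists_embedding_of_disjoint hef'
    exact Nat.exists_eq_add_of_le' (by simpa using Fintype.card_le_of_embedding x)
  have hkK : (k : K) ≠ 0 := Nat.cast_ne_zero.2 hk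
  have hchoose : 2 * ((m + 4).choose 2 : K) = (m + 4) * (m + 3) := by
    rw [Nat.cast_choose_two]
    push_cast
    ring
  rw [hessianMatrix_kirchhoffPolynomial_one_eq_of_spanningTreeCount
    (fun _ _ h v hv hv' =>
      (spanningTreeCount_completeGraph_eq_of_adjacent h hv hv' hef he hf).trans hadj)
    (fun _ _ h => (spanningTreeCount_completeGraph_eq_of_disjoint h hef').trans hdisj)]
  apply det_one_add_gram_add_vecMulVec_one_completeGraph_ne_zero
  · push_cast
    rw [show (4 * k - 2 * (3 * k) : K) = -2 * k by ring]
    simp [hkK]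
  · have h : ((m + 4 : ℕ) : K) * k ≠ 0 := mul_ne_zero (Nat.cast_ne_zero.2 (by lia)) hkK
    rw [hm]
    contrapose! h
    push_cast at h ⊢
    linear_combination -h
  · have h : 2 * ((m + 4 : ℕ) : K) * (m + 2 : ℕ) * k ≠ 0 := by
      exact_mod_cast (by positivity : 2 * (m + 4) * (m + 2) * k ≠ 0)
    rw [hm]
    contrapose! h
    push_cast at h ⊢
    linear_combination h - 2 * k * hchoose

theorem det_hessianMatrix_kirchhoffPolynomial_completeGraph_ne_zero (K : Type*) [Field K]
    [CharZero K] {n : ℕ} (hn4 : 4 ≤ n) (hn5 : n ≤ 5) :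
    (hessianMatrix (kirchhoffPolynomial K (completeGraph (Fin n))) 1).det ≠ 0 := by
  obtain rfl | rfl : n = 4 ∨ n = 5 := by lia
  · refine det_hessianMatrix_kirchhoffPolynomial_completeGraph_ne_zero_of_spanningTreeCount K
      one_ne_zero (e := ⟨s(0, 1), by simp⟩) (f := ⟨s(0, 2), by simp⟩) (v := 0)
      (by simp) (by simp) (by simp) ?_
      (e' := ⟨s(0, 1), by simp⟩) (f' := ⟨s(2, 3), by simp⟩) (by simp) ?_
    · rw [spanningTreeCount_eq_card]
      decide +kernel
    · rw [spanningTreeCount_eq_card]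
      decide +kernel
  · refine det_hessianMatrix_kirchhoffPolynomial_completeGraph_ne_zero_of_spanningTreeCount K
      (k := 5) (by simp) (e := ⟨s(0, 1), by simp⟩) (f := ⟨s(0, 2), by simp⟩) (v := 0)
      (by simp) (by simp) (by simp) ?_
      (e' := ⟨s(0, 1), by simp⟩) (f' := ⟨s(2, 3), by simp⟩) (by simp) ?_
    · rw [spanningTreeCount_eq_card]
      decide +kernel
    · rw [spanningTreeCount_eq_card]
      decide +kernel

end CompleteGraph

theorem mainTheorem5 (K : Type*) [Field K] [CharZero K] (n : ℕ) (hn : 1 ≤ n) (hn5 : n ≤ 5) :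
    IsArtinianGorenstein (GraphicAlgebra K (SimpleGraph.completeGraph (Fin n))) ∧
    IsGradedArtinian (graphicGrading K (SimpleGraph.completeGraph (Fin n))) (n - 1) ∧
    HasStrongLefschetzProperty (graphicGrading K (SimpleGraph.completeGraph (Fin n))) ∧
    IsStrongLefschetzElement (graphicGrading K (SimpleGraph.completeGraph (Fin n))) (n - 1)
      (edgeSum K (SimpleGraph.completeGraph (Fin n))) := by
  have : Nonempty (Fin n) := ⟨⟨0, hn⟩⟩
  have hG : (completeGraph (Fin n)).Connected := connected_top
  have hgraded : IsGradedArtinian (graphicGrading K (completeGraph (Fin n))) (n - 1) := by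
    simpa using isGradedArtinian_graphicGrading (K := K) hG
  have hlefschetz : IsStrongLefschetzElement (graphicGrading K (completeGraph (Fin n))) (n - 1)
      (edgeSum K (completeGraph (Fin n))) := by
    simpa using isStrongLefschetzElement_edgeSum (K := K) hG (by simpa) fun hn4 =>
      det_hessianMatrix_kirchhoffPolynomial_completeGraph_ne_zero K (by simpa using hn4) hn5
  exact ⟨isArtinianGorenstein_graphicAlgebra hG, hgraded, ⟨n - 1, hgraded, _, hlefschetz⟩,
    hlefschetz⟩
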